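/- Let $q\ge 1$, let $a<b$ be real numbers, and let $s_0,s_1,\dots$ be complex $q\times q$ matrices. Put $$\widehat s_k=-ab\,s_k+(a+b)s_{k+1}-s_{k+2},\qquad H_{1,j}=(s_{l+k})_{l,k=0}^{j},\quad H_{2,j}=(\widehat s_{l+k})_{l,k=0}^{j},$$ $$K_{1,j}=(bs_{l+k}-s_{l+k+1})_{l,k=0}^{j},\qquad K_{2,j}=(-as_{l+k}+s_{l+k+1})_{l,k=0}^{j}$$ (block matrices with $j+1$ block rows and columns). The sequence $(s_k)_{k=0}^{2n}$ is called Hausdorff positive definite if $H_{1,n}$ and (for $n\ge1$) $H_{2,n-1}$ are positive definite; $(s_k)_{k=0}^{2n+1}$ is called Hausdorff positive definite if $K_{1,n}$ and $K_{2,n}$ are positive definite. Let $T_j$ be the $(j+1)\times(j+1)$ block matrix with blocks $I_q$ on the first subdiagonal and zero blocks elsewhere, $R_j(z)=(I-zT_j)^{-1}$, and let $v_j$, $u_{2,j}$, $\widetilde u_{2,j}$ be the columns of $j+1$ blocks $$v_j=(I_q,0,\dots,0),\quad u_{2,j}=(-(a+b)s_0+s_1,\,-\widehat s_0,\dots,-\widehat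 s_{j-1}),\quad \widetilde u_{2,j}=(-s_0,\,-s_1+as_0,\dots,-s_j+as_{j-1}).$$ For $j\ge1$ let $Y_{1,j},Y_{2,j},\widetilde Y_{1,j},\widetilde Y_{2,j}$ be the columns of $j$ blocks with entries, for $j\le k\le 2j-1$, $s_k$, $\widehat s_k$, $bs_k-s_{k+1}$ and $-as_k+s_{k+1}$, respectively. Define the matrix polynomials $P_{1,0}=\Gamma_{1,0}=I_q$, $\Theta_{2,0}=-s_0$, $Q_{2,0}(z)=(a+b)s_0-s_1-zs_0$, and for $j\ge1$ $$P_{1,j}(z)=(-Y_{1,j}^*H_{1,j-1}^{-1},I_q)R_j(z)v_j,\qquad Q_{2,j}(z)=-(-Y_{2,j}^*H_{2,j-1}^{-1},I_q)R_j(z)(u_{2,j}+zv_js_0),$$ $$\Gamma_{1,j}(z)=(-\widetilde Y_{1,j}^*K_{1,j-1}^{-1},I_q)R_j(z)v_j,\qquad \Theta_{2,j}(z)=(-\widetilde Y_{2,j}^*K_{2,j-1}^{-1},I_q)R_j(z)\widetilde u_{2,j}.$$ Put $$\mathbf t_j=v_j^*R_j(a)^*K_{1,j}^{-1}R_j(a)v_j,\qquad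 \boldsymbol\lambda_j=(u_{2,j}^*+as_0v_j^*)R_j(a)^*H_{2,j}^{-1}R_j(a)(u_{2,j}+av_js_0),$$ $$\mu_j=v_j^*R_j(a)^*H_{1,j}^{-1}R_j(a)v_j,\qquad \lambda_j=\widetilde u_{2,j}^*R_j(a)^*K_{2,j}^{-1}R_j(a)\widetilde u_{2,j}.$$ The new DSM (Dyukarev--Stieltjes matrix) parameters are $\mathbf m_0=\mathbf t_0$, $\mathbf l_0=\boldsymbol\lambda_0$ and $\mathbf m_j=\mathbf t_j-\mathbf t_{j-1}$, $\mathbf l_j=\boldsymbol\lambda_j-\boldsymbol\lambda_{j-1}$ for $j\ge1$; the old ones are $M_0(a)=s_0^{-1}$, $L_0(a)=\lambda_0$ and $M_j(a)=\mu_j-\mu_{j-1}$, $L_j(a)=\lambda_j-\lambda_{j-1}$ for $j\ge1$. **Proposition 7.6.** a) Let $n\ge 1$ and let $(s_k)_{k=0}^{2n}$ be Hausdorff positive definite. Then the matrices $Q_{2,j}(a)$ and $\Gamma_{1,j+1}(a)$, $0\le j\le n-1$, are invertible, and $$\mathbf m_0=Q_{2,0}^{-1}(a),\qquad \mathbf m_j=Q_{2,j}^{-1}(a)\,\Gamma_{1,j}(a),\qquad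 \mathbf l_j=-\Gamma_{1,j+1}^{-1}(a)\,Q_{2,j}(a)\qquad(0\le j\le n-1).$$ b) Let $n\ge 0$ and let $(s_k)_{k=0}^{2n+1}$ be Hausdorff positive definite. Then the matrices $\Theta_{2,j}(a)$ and $P_{1,j+1}(a)$, $0\le j\le n$, are invertible, and $$M_0(a)=-\Theta_{2,0}^{-1}(a),\qquad M_j(a)=-\Theta_{2,j}^{-1}(a)\,P_{1,j}(a)\quad(1\le j\le n),\qquad L_j(a)=P_{1,j+1}^{-1}(a)\,\Theta_{2,j}(a)\quad(0\le j\le n).$$ -/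

import Mathlib

open scoped Matrix ComplexOrder

namespace HausdorffMoment

noncomputable section

/-- A sequence of complex `q × q` matrices; only an initial segment of it is ever used. -/
abbrev MatSeq (q : ℕ) := ℕ → Matrix (Fin q) (Fin q) ℂ

/-- `(j+1)q × (j+1)q` matrices, seen as `(j+1) × (j+1)` matrices of `q × q` blocks. -/
abbrev BlockSq (q j : ℕ) := Matrix (Fin (j + 1) × Fin q) (Fin (j + 1) × Fin q) ℂ

/-- Columns of `j+1` blocks of size `q × q`. -/
abbrev BlockCol (q j : ℕ) := Matrix (Fin (j + 1) × Fin q) (Fin q) ℂ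

/-- Rows of `j+1` blocks of size `q × q`. -/
abbrev BlockRow (q j : ℕ) := Matrix (Fin q) (Fin (j + 1) × Fin q) ℂ

variable {q : ℕ}

/-- The block column with blocks `f 0, f 1, …, f j`. -/
def blockCol (f : MatSeq q) (j : ℕ) : BlockCol q j :=
  Matrix.of fun p c => f p.1 p.2 c

/-- The block Hankel matrix with `(l, k)` block `f (l + k)`, for `0 ≤ l, k ≤ j`. -/
def blockHankel (f : MatSeq q) (j : ℕ) : BlockSq q j :=
  Matrix.of fun p r => f ((p.1 : ℕ) + (r.1 : ℕ)) p.2 r.2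

/-- `ŝ_k = -ab s_k + (a+b) s_{k+1} - s_{k+2}`. -/
def sHat (s : MatSeq q) (a b : ℝ) : MatSeq q := fun k =>
  -(((a * b : ℝ) : ℂ) • s k) + ((a + b : ℝ) : ℂ) • s (k + 1) - s (k + 2)

/-- `b s_k - s_{k+1}`. -/
def sUpper (s : MatSeq q) (b : ℝ) : MatSeq q := fun k => (b : ℂ) • s k - s (k + 1)

/-- `-a s_k + s_{k+1}`. -/
def sLower (s : MatSeq q) (a : ℝ) : MatSeq q := fun k => -((a : ℂ) • s k) + s (k + 1)

/-- `H_{1,j}`, with blocks `s_{l+k}`. -/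
def H1 (s : MatSeq q) (j : ℕ) : BlockSq q j := blockHankel s j

/-- `H_{2,j}`, with blocks `-ab s_{l+k} + (a+b) s_{l+k+1} - s_{l+k+2}`. -/
def H2 (s : MatSeq q) (a b : ℝ) (j : ℕ) : BlockSq q j := blockHankel (sHat s a b) j

/-- `K_{1,j}`, with blocks `b s_{l+k} - s_{l+k+1}`. -/
def K1 (s : MatSeq q) (b : ℝ) (j : ℕ) : BlockSq q j := blockHankel (sUpper s b) j

/-- `K_{2,j}`, with blocks `-a s_{l+k} + s_{l+k+1}`. -/
def K2 (s : MatSeq q) (a : ℝ) (j : ℕ) : BlockSq q j := blockHankel (sLower s a) j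

/-- `(s_k)_{k=0}^{2n}` is a Hausdorff positive definite sequence on `[a,b]`: both `H_{1,n}` and
`H_{2,n-1}` are positive definite (for `n = 0` there is no matrix `H_{2,n-1}`). -/
def HausdorffPosDefEven (s : MatSeq q) (a b : ℝ) (n : ℕ) : Prop :=
  (H1 s n).PosDef ∧ ∀ i, i + 1 = n → (H2 s a b i).PosDef

/-- `(s_k)_{k=0}^{2n+1}` is a Hausdorff positive definite sequence on `[a,b]`: both `K_{1,n}` and
`K_{2,n}` are positive definite. -/
def HausdorffPosDefOdd (s : MatSeq q) (a b : ℝ) (n : ℕ) : Prop :=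
  (K1 s b n).PosDef ∧ (K2 s a n).PosDef

/-- The block shift `T_j`: identity blocks just below the diagonal, zero blocks elsewhere. -/
def T (q j : ℕ) : BlockSq q j :=
  Matrix.of fun p r => if (p.1 : ℕ) = (r.1 : ℕ) + 1 ∧ p.2 = r.2 then 1 else 0

/-- `R_j(z) = (I - z T_j)⁻¹`. -/
def R (q j : ℕ) (z : ℂ) : BlockSq q j := (1 - z • T q j)⁻¹

/-- `v_j = (I, 0, …, 0)ᵀ`. -/
def v (q j : ℕ) : BlockCol q j :=
  blockCol (fun k => if k = 0 then 1 else 0) j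

/-- `u_{2,0} = -(a+b) s_0 + s_1`, a `q × q` matrix. -/
def u20 (s : MatSeq q) (a b : ℝ) : Matrix (Fin q) (Fin q) ℂ :=
  -(((a + b : ℝ) : ℂ) • s 0) + s 1

/-- `u_{2,j}`: the block column `u_{2,0}, -ŝ_0, …, -ŝ_{j-1}`. -/
def u2 (s : MatSeq q) (a b : ℝ) (j : ℕ) : BlockCol q j :=
  blockCol (fun k => match k with
    | 0 => u20 s a b
    | l + 1 => -sHat s a b l) j

/-- `ũ_{2,j}`: the block column `-s_0, -s_1 + a s_0, …, -s_j + a s_{j-1}`. -/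
def uTilde2 (s : MatSeq q) (a : ℝ) (j : ℕ) : BlockCol q j :=
  blockCol (fun k => match k with
    | 0 => -s 0
    | l + 1 => -s (l + 1) + (a : ℂ) • s l) j

/-- For a sequence `f` with block Hankel matrix `F_j = blockHankel f j` and the block column
`Y_{j+1} = (f_{j+1}, …, f_{2j+1})ᵀ`, this is the block row `(-Y_{j+1}ᴴ F_j⁻¹, I)` of `j+2` blocks.
It is the row that enters the definition of the polynomials of index `j + 1`. -/
def orthoRow (f : MatSeq q) (j : ℕ) : BlockRow q (j + 1) :=
  Matrix.of fun i p =>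
    if h : (p.1 : ℕ) < j + 1 then
      (-((blockCol (fun k => f (j + 1 + k)) j)ᴴ * (blockHankel f j)⁻¹)) i (⟨p.1, h⟩, p.2)
    else (1 : Matrix (Fin q) (Fin q) ℂ) i p.2

/-- `P_{1,0} = I`, `P_{1,j}(z) = (-Y_{1,j}ᴴ H_{1,j-1}⁻¹, I) R_j(z) v_j`. -/
def P1 (s : MatSeq q) : ℕ → ℂ → Matrix (Fin q) (Fin q) ℂ
  | 0, _ => 1
  | j + 1, z => orthoRow s j * R q (j + 1) z * v q (j + 1)

/-- `Q_{2,0}(z) = -(u_{2,0} + z s_0)`,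
`Q_{2,j}(z) = -(-Y_{2,j}ᴴ H_{2,j-1}⁻¹, I) R_j(z) (u_{2,j} + z v_j s_0)`. -/
def Q2 (s : MatSeq q) (a b : ℝ) : ℕ → ℂ → Matrix (Fin q) (Fin q) ℂ
  | 0, z => -(u20 s a b + z • s 0)
  | j + 1, z => -(orthoRow (sHat s a b) j * R q (j + 1) z *
      (u2 s a b (j + 1) + z • (v q (j + 1) * s 0)))

/-- `Γ_{1,0} = I`, `Γ_{1,j}(z) = (-Ỹ_{1,j}ᴴ K_{1,j-1}⁻¹, I) R_j(z) v_j`. -/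
def Gamma1 (s : MatSeq q) (b : ℝ) : ℕ → ℂ → Matrix (Fin q) (Fin q) ℂ
  | 0, _ => 1
  | j + 1, z => orthoRow (sUpper s b) j * R q (j + 1) z * v q (j + 1)

/-- `Θ_{2,0} = -s_0`, `Θ_{2,j}(z) = (-Ỹ_{2,j}ᴴ K_{2,j-1}⁻¹, I) R_j(z) ũ_{2,j}`. -/
def Theta2 (s : MatSeq q) (a : ℝ) : ℕ → ℂ → Matrix (Fin q) (Fin q) ℂ
  | 0, _ => -s 0
  | j + 1, z => orthoRow (sLower s a) j * R q (j + 1) z * uTilde2 s a (j + 1)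

/-- `v_jᴴ R_j(a)ᴴ K_{1,j}⁻¹ R_j(a) v_j`. -/
def tNew (s : MatSeq q) (a b : ℝ) (j : ℕ) : Matrix (Fin q) (Fin q) ℂ :=
  (v q j)ᴴ * (R q j a)ᴴ * (K1 s b j)⁻¹ * R q j a * v q j

/-- `(u_{2,j}ᴴ + a s_0 v_jᴴ) R_j(a)ᴴ H_{2,j}⁻¹ R_j(a) (u_{2,j} + a v_j s_0)`. -/
def lSum (s : MatSeq q) (a b : ℝ) (j : ℕ) : Matrix (Fin q) (Fin q) ℂ :=
  ((u2 s a b j)ᴴ + (a : ℂ) • (s 0 * (v q j)ᴴ)) * (R q j a)ᴴ * (H2 s a b j)⁻¹ * R q j a *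
    (u2 s a b j + (a : ℂ) • (v q j * s 0))

/-- The new (second type) Dyukarev–Stieltjes parameters `𝐦_j(a,b)`. -/
def mNew (s : MatSeq q) (a b : ℝ) : ℕ → Matrix (Fin q) (Fin q) ℂ
  | 0 => tNew s a b 0
  | j + 1 => tNew s a b (j + 1) - tNew s a b j

/-- The new (second type) Dyukarev–Stieltjes parameters `𝐥_j(a,b)`, `j ≥ 0`. -/
def lNew (s : MatSeq q) (a b : ℝ) : ℕ → Matrix (Fin q) (Fin q) ℂ
  | 0 => ((u2 s a b 0)ᴴ + (a : ℂ) • (s 0 * (v q 0)ᴴ)) * (H2 s a b 0)⁻¹ *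
      (u2 s a b 0 + (a : ℂ) • (v q 0 * s 0))
  | j + 1 => lSum s a b (j + 1) - lSum s a b j

/-- `v_jᴴ R_j(a)ᴴ H_{1,j}⁻¹ R_j(a) v_j`. -/
def mSumOld (s : MatSeq q) (a : ℝ) (j : ℕ) : Matrix (Fin q) (Fin q) ℂ :=
  (v q j)ᴴ * (R q j a)ᴴ * (H1 s j)⁻¹ * R q j a * v q j

/-- `ũ_{2,j}ᴴ R_j(a)ᴴ K_{2,j}⁻¹ R_j(a) ũ_{2,j}`. -/
def lSumOld (s : MatSeq q) (a : ℝ) (j : ℕ) : Matrix (Fin q) (Fin q) ℂ :=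
  (uTilde2 s a j)ᴴ * (R q j a)ᴴ * (K2 s a j)⁻¹ * R q j a * uTilde2 s a j

/-- The old (first type) Dyukarev–Stieltjes parameters `M_j(a)`. -/
def mOld (s : MatSeq q) (a : ℝ) : ℕ → Matrix (Fin q) (Fin q) ℂ
  | 0 => (s 0)⁻¹
  | j + 1 => mSumOld s a (j + 1) - mSumOld s a j

/-- The old (first type) Dyukarev–Stieltjes parameters `L_j(a)`. -/
def lOld (s : MatSeq q) (a : ℝ) : ℕ → Matrix (Fin q) (Fin q) ℂ
  | 0 => (uTilde2 s a 0)ᴴ * (K2 s a 0)⁻¹ * uTilde2 s a 0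
  | j + 1 => lSumOld s a (j + 1) - lSumOld s a j

end

end HausdorffMoment

open HausdorffMoment

/-!
A parameter is the increment of the form `xᴴ F⁻¹ x` when the block Hankel matrix `F` is bordered by
one more block row and column. This increment is `Yᴴ N⁻¹ Y`, where the Schur complement `N` is the
squared norm of the next monic orthogonal polynomial `p` of the moment sequence, and `Y` is `p(a)`
or the functional of another moment sequence at `p`.

Let `p_j` and `r_j` be the monic orthogonal polynomials of the moment sequences of `σ` and
`(x - a) σ`. As in the theory of Christoffel transforms, dividing by `x - a` with remainder in
`⟨p_j, r_j⟩` and in `⟨p_{j+1}, r_j⟩` factorizes the two squared norms as `-Θ_j(a) P_j(a)ᴴ` and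
`P_{j+1}(a) Θ_j(a)ᴴ`. Hence these values are invertible and one factor cancels in `Yᴴ N⁻¹ Y`. The
new parameters are the old ones of `(b - x) σ`.

The leading minors of the Hankel matrices of `σ` are invertible because
`(b - a) σ = (b - x) σ + (x - a) σ` is positive; with `(b - x) σ` in place of `σ`, this uses the
positivity of `(b - x)² σ`.
-/

namespace HausdorffMoment

open Polynomial

section Moments

variable {A : Type*} [Ring A]

/-- The functional `∑ cᵢ Xⁱ ↦ ∑ cᵢ xᵢ` with moments `x`, on polynomials with coefficients on the
left. -/
noncomputable def momentFunctional (x : ℕ → A) : A[X] →ₗ[A] A :=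
  lsum fun i => LinearMap.toSpanSingleton A A (x i)

theorem momentFunctional_eq_sum_range (x : ℕ → A) {p : A[X]} {n : ℕ} (hp : p.natDegree ≤ n) :
    momentFunctional x p = ∑ i ∈ Finset.range (n + 1), p.coeff i * x i :=
  p.sum_over_range' (f := fun i c => c * x i) (fun _ => zero_mul _) (n + 1) (Nat.lt_succ_of_le hp)

theorem momentFunctional_monomial (x : ℕ → A) (n : ℕ) (c : A) :
    momentFunctional x (monomial n c) = c * x n :=
  sum_monomial_index c _ (zero_mul _)

theorem momentFunctional_pow (z : A) (p : A[X]) :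
    momentFunctional (fun i => z ^ i) p = p.eval z :=
  eval_eq_sum.symm

theorem momentFunctional_X_sub_C_mul {a : A} (ha : ∀ c, Commute a c) (x : ℕ → A) (p : A[X]) :
    momentFunctional x ((X - C a) * p) = momentFunctional (fun i => x (i + 1) - a * x i) p := by
  induction p using Polynomial.induction_on' with
  | add p r hp hr => rw [mul_add, map_add, map_add, hp, hr]
  | monomial n c =>
    simp only [sub_mul, X_mul_monomial, C_mul_monomial, map_sub, momentFunctional_monomial,
      mul_sub, (ha c).eq, mul_assoc]

theorem momentFunctional_eq_eval_mul_add {a : A} (ha : ∀ c, Commute a c) (x : ℕ → A) (p : A[X]) :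
    momentFunctional x p =
      p.eval a * x 0 + momentFunctional (fun i => x (i + 1) - a * x i) (p /ₘ (X - C a)) := by
  nontriviality A
  obtain ⟨c, hc⟩ : ∃ c, p %ₘ (X - C a) = C c :=
    ⟨_, eq_C_of_degree_le_zero <| Nat.WithBot.lt_one_iff_le_zero.mp <|
      degree_X_sub_C a ▸ degree_modByMonic_lt p (monic_X_sub_C a)⟩
  have expand (y : ℕ → A) : momentFunctional y p =
      c * y 0 + momentFunctional (fun i => y (i + 1) - a * y i) (p /ₘ (X - C a)) := by
    rw [← momentFunctional_X_sub_C_mul ha, ← momentFunctional_monomial, monomial_zero_left, ← hc,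
      ← map_add, modByMonic_add_div]
  have eval_eq : p.eval a = c := by
    rw [← momentFunctional_pow, expand]
    simp [pow_succ', momentFunctional_eq_sum_range _ le_rfl]
  rw [eval_eq, expand]

theorem coeff_divByMonic_X_sub_C_of_natDegree_le {p : A[X]} {n : ℕ} (hp : p.natDegree ≤ n + 1)
    (a : A) : (p /ₘ (X - C a)).coeff n = p.coeff (n + 1) := by
  nontriviality A
  have hdeg : (p /ₘ (X - C a)).natDegree < n + 1 := by
    rw [natDegree_divByMonic p (monic_X_sub_C a), natDegree_X_sub_C]
    omega
  rw [coeff_divByMonic_X_sub_C_rec, coeff_eq_zero_of_natDegree_lt hdeg, mul_zero, add_zero]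

theorem momentFunctional_sub_mul {a : A} (ha : ∀ c, Commute a c) (x y : ℕ → A) (p : A[X]) :
    momentFunctional (fun i => y i - a * x i) p =
      momentFunctional y p - a * momentFunctional x p := by
  simp only [momentFunctional_eq_sum_range _ le_rfl, mul_sub, Finset.sum_sub_distrib,
    Finset.mul_sum, (ha _).left_comm]

variable [StarRing A]

/-- The sesquilinear form `⟨p, r⟩ = ∑ pᵢ g_{i+k} r_k⋆` of a self-adjoint moment sequence `g`. The
inner sum is written as `(∑ r_k g_{i+k})⋆`, so that both sums are moment functionals. -/
noncomputable def momentForm (g : ℕ → A) (p r : A[X]) : A :=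
  momentFunctional (fun i => star (momentFunctional (fun k => g (i + k)) r)) p

theorem star_momentForm {g : ℕ → A} {p r : A[X]} {m n : ℕ} (hp : p.natDegree ≤ m)
    (hr : r.natDegree ≤ n) (hg : ∀ k ≤ m + n, IsSelfAdjoint (g k)) :
    star (momentForm g p r) = momentForm g r p := by
  simp only [momentForm, momentFunctional_eq_sum_range _ hp, momentFunctional_eq_sum_range _ hr,
    star_sum, star_mul, star_star, Finset.mul_sum]
  rw [Finset.sum_comm]
  refine Finset.sum_congr rfl fun k hk => Finset.sum_congr rfl fun i hi => ?_
  have hik : i + k ≤ m + n := by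
    have := Finset.mem_range.mp hk
    have := Finset.mem_range.mp hi
    omega
  rw [add_comm k i, (hg _ hik).star_eq, mul_assoc]

theorem momentForm_eq_eval_mul_add {a : A} (ha : ∀ c, Commute a c) (hsa : IsSelfAdjoint a)
    (g : ℕ → A) (p r : A[X]) :
    momentForm g p r = p.eval a * star (momentFunctional g r) +
      momentForm (fun k => g (k + 1) - a * g k) (p /ₘ (X - C a)) r := by
  rw [momentForm, momentFunctional_eq_eval_mul_add ha]
  have shift (i : ℕ) : star (momentFunctional (fun k => g (i + k + 1) - a * g (i + k)) r) =
      star (momentFunctional (fun k => g (i + 1 + k)) r) -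
        a * star (momentFunctional (fun k => g (i + k)) r) := by
    rw [momentFunctional_sub_mul ha, star_sub, star_mul, hsa.star_eq, (ha _).eq]
    simp only [add_right_comm]
  simp only [momentForm, shift, zero_add]

/-- `p` is the monic polynomial of degree `n` which is orthogonal to all polynomials of lower
degree. Monicity is stated through the coefficients, so that it makes sense in the zero ring. -/
structure IsMonicOrthogonal (g : ℕ → A) (n : ℕ) (p : A[X]) : Prop where
  natDegree_le : p.natDegree ≤ n
  coeff_self : p.coeff n = 1
  apply_shift : ∀ l < n, momentFunctional (fun k => g (l + k)) p = 0

/-- The squared norm `⟨p, p⟩` of the monic orthogonal polynomial `p` of degree `n`, in the form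
`⟨p, Xⁿ⟩`. -/
noncomputable def momentNorm (g : ℕ → A) (n : ℕ) (p : A[X]) : A :=
  momentFunctional (fun k => g (n + k)) p

namespace IsMonicOrthogonal

variable {f g : ℕ → A} {m n : ℕ} {p r : A[X]}

theorem momentForm_eq_coeff_mul (hr : IsMonicOrthogonal g n r) (hp : p.natDegree ≤ n) :
    momentForm g p r = p.coeff n * star (momentNorm g n r) := by
  rw [momentForm, momentFunctional_eq_sum_range _ hp, Finset.sum_range_succ, Finset.sum_eq_zero,
    zero_add, momentNorm]
  intro l hl
  rw [hr.apply_shift l (Finset.mem_range.mp hl), star_zero, mul_zero]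

theorem isSelfAdjoint_momentNorm (hp : IsMonicOrthogonal g n p)
    (hg : ∀ k ≤ n + n, IsSelfAdjoint (g k)) : IsSelfAdjoint (momentNorm g n p) := by
  have norm_eq : momentForm g p p = star (momentNorm g n p) := by
    rw [hp.momentForm_eq_coeff_mul hp.natDegree_le, hp.coeff_self, one_mul]
  rw [← IsSelfAdjoint.star_iff, ← norm_eq]
  exact star_momentForm hp.natDegree_le hp.natDegree_le hg

theorem momentNorm_mul_star_coeff {a : A} (hp : IsMonicOrthogonal g m p)
    (hr : IsMonicOrthogonal f n r) (ha : ∀ c, Commute a c) (hsa : IsSelfAdjoint a)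
    (hgf : ∀ k, f k = g (k + 1) - a * g k) (hnm : n ≤ m) (hmn : m ≤ n + 1)
    (hg : ∀ k ≤ m + n, IsSelfAdjoint (g k)) :
    momentNorm g m p * star (r.coeff m) =
      p.eval a * star (momentFunctional g r) + p.coeff (n + 1) * star (momentNorm f n r) := by
  have hq : (p /ₘ (X - C a)).natDegree ≤ n := by
    nontriviality A
    have := hp.natDegree_le
    rw [natDegree_divByMonic p (monic_X_sub_C a), natDegree_X_sub_C]
    omega
  rw [← coeff_divByMonic_X_sub_C_of_natDegree_le (hp.natDegree_le.trans hmn) a,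
    ← hr.momentForm_eq_coeff_mul hq, funext hgf, ← momentForm_eq_eval_mul_add ha hsa,
    ← star_momentForm hr.natDegree_le hp.natDegree_le (by rwa [add_comm]),
    hp.momentForm_eq_coeff_mul (hr.natDegree_le.trans hnm), star_mul, star_star]

theorem momentNorm_eq {a : A} (hp : IsMonicOrthogonal g n p)
    (hr : IsMonicOrthogonal f n r) (ha : ∀ c, Commute a c) (hsa : IsSelfAdjoint a)
    (hgf : ∀ k, f k = g (k + 1) - a * g k) (hg : ∀ k ≤ n + n, IsSelfAdjoint (g k)) :
    momentNorm g n p = p.eval a * star (momentFunctional g r) := by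
  simpa [hr.coeff_self, coeff_eq_zero_of_natDegree_lt (Nat.lt_succ_of_le hp.natDegree_le)] using
    hp.momentNorm_mul_star_coeff hr ha hsa hgf le_rfl n.le_succ hg

theorem momentNorm_shift_eq {a : A} (hp : IsMonicOrthogonal g (n + 1) p)
    (hr : IsMonicOrthogonal f n r) (ha : ∀ c, Commute a c) (hsa : IsSelfAdjoint a)
    (hgf : ∀ k, f k = g (k + 1) - a * g k) (hg : ∀ k ≤ n + 1 + n, IsSelfAdjoint (g k)) :
    momentNorm f n r = -(p.eval a * star (momentFunctional g r)) := by
  have hf (k : ℕ) (hk : k ≤ n + n) : IsSelfAdjoint (f k) := by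
    rw [hgf]
    exact (hg _ (by omega)).sub ((hsa.commute_iff (hg _ (by omega))).mp (ha _))
  have h := hp.momentNorm_mul_star_coeff hr ha hsa hgf n.le_succ le_rfl hg
  rw [coeff_eq_zero_of_natDegree_lt (Nat.lt_succ_of_le hr.natDegree_le), star_zero, mul_zero,
    hp.coeff_self, one_mul, (hr.isSelfAdjoint_momentNorm hf).star_eq] at h
  exact (neg_eq_of_add_eq_zero_right h.symm).symm

end IsMonicOrthogonal

end Moments

section Schur

open Matrix

variable {l m n o α : Type*} [CommRing α]
  [Fintype m] [DecidableEq m] [Fintype n] [DecidableEq n]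
  {A : Matrix m m α} {B : Matrix m n α} {C : Matrix n m α} {D : Matrix n n α}

theorem isUnit_schurComplement (hA : IsUnit A) (hM : IsUnit (fromBlocks A B C D)) :
    IsUnit (D - C * A⁻¹ * B) := by
  let _ := hA.invertible
  rwa [isUnit_fromBlocks_iff_of_invertible₁₁, invOf_eq_nonsing_inv] at hM

theorem fromCols_mul_inv_mul_fromRows (hA : IsUnit A) (hM : IsUnit (fromBlocks A B C D))
    (u : Matrix l m α) (w : Matrix l n α) (x : Matrix m o α) (y : Matrix n o α) :
    fromCols u w * (fromBlocks A B C D)⁻¹ * fromRows x y =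
      u * A⁻¹ * x +
        (w - u * A⁻¹ * B) * (D - C * A⁻¹ * B)⁻¹ * (y - C * A⁻¹ * x) := by
  let _ := hA.invertible
  let _ := hM.invertible
  let _ : Invertible (D - C * ⅟A * B) :=
    (isUnit_fromBlocks_iff_of_invertible₁₁.mp hM).invertible
  rw [← invOf_eq_nonsing_inv (fromBlocks A B C D), invOf_fromBlocks₁₁_eq]
  simp only [invOf_eq_nonsing_inv, fromCols_mul_fromBlocks, fromCols_mul_fromRows,
    Matrix.mul_add, Matrix.add_mul, Matrix.mul_sub, Matrix.sub_mul, Matrix.mul_neg,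
    Matrix.neg_mul, Matrix.mul_assoc]
  abel

theorem inv_neg_of_isUnit (hA : IsUnit A) : (-A)⁻¹ = -A⁻¹ :=
  inv_eq_left_inv <| by
    rw [neg_mul_neg, nonsing_inv_mul _ ((isUnit_iff_isUnit_det _).mp hA)]

theorem mul_mul_inv_cancel_left_of_isUnit (X : Matrix m m α) {Y : Matrix m m α} (hY : IsUnit Y) :
    Y * (X * Y)⁻¹ = X⁻¹ := by
  rw [Matrix.mul_inv_rev, mul_nonsing_inv_cancel_left _ _ ((isUnit_iff_isUnit_det _).mp hY)]

end Schur

section Blocks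

variable {q : ℕ}

/-- The bijection which splits off the last of `j + 2` blocks of size `q`. -/
def lastBlockEquiv (q j : ℕ) : (Fin (j + 1) × Fin q) ⊕ Fin q ≃ Fin (j + 2) × Fin q :=
  ((Equiv.refl _).sumCongr (Equiv.uniqueProd (Fin q) (Fin 1)).symm).trans
    ((Equiv.sumProdDistrib _ _ _).symm.trans (finSumFinEquiv.prodCongr (Equiv.refl _)))

@[simp]
theorem lastBlockEquiv_inl (j : ℕ) (p : Fin (j + 1) × Fin q) :
    lastBlockEquiv q j (Sum.inl p) = (p.1.castSucc, p.2) :=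
  rfl

@[simp]
theorem lastBlockEquiv_inr (j : ℕ) (c : Fin q) :
    lastBlockEquiv q j (Sum.inr c) = (Fin.last (j + 1), c) :=
  rfl

theorem blockCol_succ_submatrix (x : MatSeq q) (j : ℕ) :
    (blockCol x (j + 1)).submatrix (lastBlockEquiv q j) id =
      Matrix.fromRows (blockCol x j) (x (j + 1)) := by
  ext (_ | _) d <;> simp [blockCol]

theorem orthoRow_submatrix (f : MatSeq q) (j : ℕ) :
    (orthoRow f j).submatrix id (lastBlockEquiv q j) =
      Matrix.fromCols (-((blockCol (fun k => f (j + 1 + k)) j)ᴴ * (blockHankel f j)⁻¹)) 1 := by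
  ext d (⟨i, c⟩ | c)
  · simp [orthoRow, Nat.lt_succ_iff.mp i.2]
  · simp [orthoRow]

theorem orthoRow_mul_blockCol (f x : MatSeq q) (j : ℕ) :
    orthoRow f j * blockCol x (j + 1) =
      x (j + 1) - (blockCol (fun k => f (j + 1 + k)) j)ᴴ * (blockHankel f j)⁻¹ * blockCol x j := by
  rw [← Matrix.submatrix_id_id (_ * _), ← Matrix.submatrix_mul_equiv _ _ id (lastBlockEquiv q j) id,
    orthoRow_submatrix, blockCol_succ_submatrix, Matrix.fromCols_mul_fromRows, Matrix.one_mul,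
    Matrix.neg_mul, neg_add_eq_sub]

theorem blockHankel_succ_submatrix {f : MatSeq q} {j : ℕ}
    (hf : ∀ k ≤ 2 * j + 1, (f k).IsHermitian) :
    (blockHankel f (j + 1)).submatrix (lastBlockEquiv q j) (lastBlockEquiv q j) =
      Matrix.fromBlocks (blockHankel f j) (blockCol (fun k => f (j + 1 + k)) j)
        (blockCol (fun k => f (j + 1 + k)) j)ᴴ (f (j + 1 + (j + 1))) := by
  ext (⟨i, c⟩ | c) (⟨k, d⟩ | d)
  · simp [blockHankel]
  · simp [blockHankel, blockCol, add_comm]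
  · simpa [blockHankel, blockCol] using ((hf (j + 1 + k) (by omega)).apply c d).symm
  · simp [blockHankel]

end Blocks

section Orthogonal

variable {q : ℕ}

/-- The matrix polynomial `∑ wᵢ Xⁱ` whose coefficients are the blocks of the row `w`. -/
noncomputable def rowPoly {j : ℕ} (w : BlockRow q j) : (Matrix (Fin q) (Fin q) ℂ)[X] :=
  ∑ i : Fin (j + 1), monomial i (w.submatrix id (Prod.mk i))

theorem momentFunctional_rowPoly {j : ℕ} (x : MatSeq q) (w : BlockRow q j) :
    momentFunctional x (rowPoly w) = w * blockCol x j := by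
  ext c d
  simp [rowPoly, momentFunctional_monomial, Matrix.sum_apply, Matrix.mul_apply, blockCol,
    Fintype.sum_prod_type]

theorem natDegree_rowPoly_le {j : ℕ} (w : BlockRow q j) : (rowPoly w).natDegree ≤ j :=
  natDegree_sum_le_of_forall_le _ _ fun i _ =>
    (natDegree_monomial_le _).trans (Nat.lt_succ_iff.mp i.2)

theorem coeff_rowPoly {j : ℕ} (w : BlockRow q j) (i : Fin (j + 1)) :
    (rowPoly w).coeff i = w.submatrix id (Prod.mk i) := by
  simp [rowPoly, coeff_monomial, Fin.val_inj]

/-- The monic orthogonal polynomials of the moment sequence `f`: the coefficients of the one of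
degree `j + 1` are the blocks of `orthoRow f j`. -/
noncomputable def orthoPoly (f : MatSeq q) : ℕ → (Matrix (Fin q) (Fin q) ℂ)[X]
  | 0 => 1
  | j + 1 => rowPoly (orthoRow f j)

theorem momentFunctional_orthoPoly_zero (f x : MatSeq q) :
    momentFunctional x (orthoPoly f 0) = x 0 := by
  rw [orthoPoly, ← monomial_zero_one, momentFunctional_monomial, one_mul]

theorem momentFunctional_orthoPoly_succ (f x : MatSeq q) (j : ℕ) :
    momentFunctional x (orthoPoly f (j + 1)) = orthoRow f j * blockCol x (j + 1) :=
  momentFunctional_rowPoly x _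

theorem isMonicOrthogonal_orthoPoly {f : MatSeq q} : ∀ {j : ℕ},
    (∀ k < 2 * j, IsSelfAdjoint (f k)) → (∀ i < j, IsUnit (blockHankel f i)) →
      IsMonicOrthogonal f j (orthoPoly f j)
  | 0, _, _ => ⟨natDegree_one.le, coeff_one_zero, fun _ hl => (Nat.not_lt_zero _ hl).elim⟩
  | j + 1, hf, hu => by
    refine ⟨natDegree_rowPoly_le _, ?_, fun l hl => ?_⟩
    · refine (coeff_rowPoly (orthoRow f j) (Fin.last (j + 1))).trans ?_
      ext c d
      simp [orthoRow]
    · have col_eq : blockCol (fun k => f (l + k)) j =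
          (blockHankel f j).submatrix id (Prod.mk ⟨l, hl⟩) := by
        ext p d
        simp [blockCol, blockHankel, add_comm]
      rw [momentFunctional_orthoPoly_succ, orthoRow_mul_blockCol, col_eq,
        ← Matrix.submatrix_id_id (_ᴴ * _), ← Matrix.submatrix_mul _ _ _ _ _ Function.bijective_id,
        Matrix.nonsing_inv_mul_cancel_right _ _
          ((Matrix.isUnit_iff_isUnit_det _).mp (hu j j.lt_succ_self)), sub_eq_zero, add_comm l]
      exact (hf (j + 1 + l) (by omega)).star_eq.symm

/-- A nondegenerate substitute for positive definiteness of `blockHankel f n`: this matrix is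
Hermitian and all its leading block minors are invertible. -/
structure IsQuasiDefinite (f : MatSeq q) (n : ℕ) : Prop where
  isHermitian : (blockHankel f n).IsHermitian
  isUnit : ∀ j ≤ n, IsUnit (blockHankel f j)

namespace IsQuasiDefinite

variable {f : MatSeq q} {j n : ℕ}

theorem isSelfAdjoint (hf : IsQuasiDefinite f n) {k : ℕ} (hk : k ≤ n + n) :
    IsSelfAdjoint (f k) := by
  ext c d
  have hlt : min k n < n + 1 ∧ k - n < n + 1 := by omega
  have h := hf.isHermitian.apply (⟨min k n, hlt.1⟩, c) (⟨k - n, hlt.2⟩, d)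
  have hsum : min k n + (k - n) = k ∧ (k - n) + min k n = k := by omega
  simpa [blockHankel, hsum, Matrix.star_apply] using h

theorem mono (hf : IsQuasiDefinite f n) (hj : j ≤ n) : IsQuasiDefinite f j where
  isHermitian := by
    ext p r
    exact congr_fun₂ (hf.isSelfAdjoint (k := r.1 + p.1) (by omega)) p.2 r.2 |>.trans <| by
      simp [blockHankel, add_comm]
  isUnit i hi := hf.isUnit i (hi.trans hj)

end IsQuasiDefinite

theorem momentNorm_orthoPoly_zero (f : MatSeq q) : momentNorm f 0 (orthoPoly f 0) = f 0 :=
  momentFunctional_orthoPoly_zero f _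

theorem momentNorm_orthoPoly_succ (f : MatSeq q) (j : ℕ) :
    momentNorm f (j + 1) (orthoPoly f (j + 1)) =
      f (j + 1 + (j + 1)) - (blockCol (fun k => f (j + 1 + k)) j)ᴴ * (blockHankel f j)⁻¹ *
        blockCol (fun k => f (j + 1 + k)) j := by
  rw [momentNorm, momentFunctional_orthoPoly_succ, orthoRow_mul_blockCol]

/-- The form `xᴴ F⁻¹ x` of the inverse of the block Hankel matrix `F` of `f`. -/
noncomputable def invForm (f x : MatSeq q) (j : ℕ) : Matrix (Fin q) (Fin q) ℂ :=
  (blockCol x j)ᴴ * (blockHankel f j)⁻¹ * blockCol x j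

theorem blockHankel_zero_submatrix (f : MatSeq q) :
    (blockHankel f 0).submatrix (Equiv.uniqueProd (Fin q) (Fin 1)).symm
      (Equiv.uniqueProd (Fin q) (Fin 1)).symm = f 0 :=
  rfl

theorem invForm_zero (f x : MatSeq q) : invForm f x 0 = (x 0)ᴴ * (f 0)⁻¹ * x 0 := by
  rw [← blockHankel_zero_submatrix f, Matrix.inv_submatrix_equiv, invForm,
    ← Matrix.submatrix_id_id (_ * _ * _),
    ← Matrix.submatrix_mul_equiv _ _ _ (Equiv.uniqueProd (Fin q) (Fin 1)).symm,
    ← Matrix.submatrix_mul_equiv _ _ _ (Equiv.uniqueProd (Fin q) (Fin 1)).symm]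
  rfl

theorem IsQuasiDefinite.isUnit_fromBlocks {f : MatSeq q} {j : ℕ} (hf : IsQuasiDefinite f (j + 1)) :
    IsUnit (Matrix.fromBlocks (blockHankel f j) (blockCol (fun k => f (j + 1 + k)) j)
        (blockCol (fun k => f (j + 1 + k)) j)ᴴ (f (j + 1 + (j + 1)))) := by
  rw [← blockHankel_succ_submatrix fun k hk => hf.isSelfAdjoint (by omega),
    Matrix.isUnit_submatrix_equiv]
  exact hf.isUnit _ le_rfl

theorem IsQuasiDefinite.isUnit_momentNorm {f : MatSeq q} :
    ∀ {j : ℕ}, IsQuasiDefinite f j → IsUnit (momentNorm f j (orthoPoly f j))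
  | 0, hf => by
    rw [momentNorm_orthoPoly_zero, ← blockHankel_zero_submatrix f, Matrix.isUnit_submatrix_equiv]
    exact hf.isUnit 0 le_rfl
  | j + 1, hf => by
    rw [momentNorm_orthoPoly_succ]
    exact isUnit_schurComplement (hf.isUnit j j.le_succ) hf.isUnit_fromBlocks

theorem IsQuasiDefinite.invForm_succ {f : MatSeq q} {j : ℕ} (hf : IsQuasiDefinite f (j + 1))
    (x : MatSeq q) :
    invForm f x (j + 1) = invForm f x j +
      (momentFunctional x (orthoPoly f (j + 1)))ᴴ *
        (momentNorm f (j + 1) (orthoPoly f (j + 1)))⁻¹ *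
          momentFunctional x (orthoPoly f (j + 1)) := by
  have inv_isHermitian : (blockHankel f j)⁻¹ᴴ = (blockHankel f j)⁻¹ :=
    (hf.mono j.le_succ).isHermitian.inv
  rw [invForm, ← Matrix.submatrix_id_id (_ * _ * _),
    ← Matrix.submatrix_mul_equiv _ _ _ (lastBlockEquiv q j),
    ← Matrix.submatrix_mul_equiv _ _ _ (lastBlockEquiv q j), ← Matrix.inv_submatrix_equiv,
    blockHankel_succ_submatrix fun k hk => hf.isSelfAdjoint (by omega),
    ← Matrix.conjTranspose_submatrix, blockCol_succ_submatrix,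
    Matrix.conjTranspose_fromRows_eq_fromCols_conjTranspose,
    fromCols_mul_inv_mul_fromRows (hf.isUnit j j.le_succ) hf.isUnit_fromBlocks,
    momentNorm_orthoPoly_succ, momentFunctional_orthoPoly_succ, orthoRow_mul_blockCol, invForm]
  simp only [Matrix.conjTranspose_sub, Matrix.conjTranspose_mul, inv_isHermitian,
    Matrix.conjTranspose_conjTranspose, Matrix.mul_assoc]

end Orthogonal

section Resolvent

variable {q : ℕ}

theorem T_mul_blockCol (x : MatSeq q) (j : ℕ) :
    T q j * blockCol x j = blockCol (fun k => Nat.casesOn k 0 x) j := by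
  ext ⟨⟨i, hi⟩, c⟩ d
  rw [Matrix.mul_apply, Fintype.sum_prod_type]
  cases i with
  | zero => simp [T, blockCol]
  | succ i =>
    rw [Finset.sum_eq_single_of_mem ⟨i, by omega⟩ (Finset.mem_univ _)]
    · simp [T, blockCol]
    · intro k _ hk
      have hik : i ≠ k := fun h => hk (Fin.ext h.symm)
      simp [T, hik]

theorem T_pow_apply_of_lt {j k : ℕ} {p : Fin (j + 1) × Fin q} (hp : (p.1 : ℕ) < k)
    (r : Fin (j + 1) × Fin q) : (T q j ^ k) p r = 0 := by
  induction k generalizing p with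
  | zero => exact (Nat.not_lt_zero _ hp).elim
  | succ k ih =>
    rw [pow_succ', Matrix.mul_apply]
    refine Finset.sum_eq_zero fun t _ => ?_
    by_cases ht : (p.1 : ℕ) = t.1 + 1
    · rw [ih (by omega), mul_zero]
    · simp [T, ht]

theorem isNilpotent_T (j : ℕ) : IsNilpotent (T q j) :=
  ⟨j + 1, Matrix.ext fun p r => T_pow_apply_of_lt p.1.2 r⟩

theorem R_mul_blockCol {x y : MatSeq q} {z : ℂ} (h0 : y 0 = x 0)
    (h : ∀ k, y (k + 1) = x (k + 1) - z • x k) (j : ℕ) :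
    R q j z * blockCol y j = blockCol x j := by
  have hy : blockCol y j = (1 - z • T q j) * blockCol x j := by
    rw [Matrix.sub_mul, Matrix.one_mul, Matrix.smul_mul, T_mul_blockCol]
    ext ⟨⟨i, hi⟩, c⟩ d
    cases i <;> simp [blockCol, h0, h]
  rw [hy, R, Matrix.nonsing_inv_mul_cancel_left _ _
    ((Matrix.isUnit_iff_isUnit_det _).mp ((isNilpotent_T j).smul z).isUnit_one_sub)]

theorem R_mul_v (j : ℕ) (z : ℂ) :
    R q j z * v q j = blockCol (fun i => algebraMap ℂ (Matrix (Fin q) (Fin q) ℂ) z ^ i) j :=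
  R_mul_blockCol (by simp) (fun k => by simp [pow_succ', Algebra.smul_def]) j

theorem R_mul_uTilde2 (s : MatSeq q) (a : ℝ) (j : ℕ) : R q j a * uTilde2 s a j = -blockCol s j :=
  R_mul_blockCol (x := fun k => -s k) rfl (fun k => by rw [smul_neg, sub_neg_eq_add]) j

end Resolvent

section Stieltjes

variable {q : ℕ}

theorem sLower_eq_sub (s : MatSeq q) (a : ℝ) (k : ℕ) :
    sLower s a k = s (k + 1) - algebraMap ℂ (Matrix (Fin q) (Fin q) ℂ) a * s k := by
  rw [sLower, ← Algebra.smul_def, neg_add_eq_sub]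

theorem P1_eq_eval (s : MatSeq q) (j : ℕ) (z : ℂ) :
    P1 s j z = (orthoPoly s j).eval (algebraMap ℂ (Matrix (Fin q) (Fin q) ℂ) z) := by
  cases j with
  | zero => exact eval_one.symm
  | succ j =>
    rw [P1, Matrix.mul_assoc, R_mul_v, ← momentFunctional_orthoPoly_succ, momentFunctional_pow]

theorem Theta2_eq_neg_momentFunctional (s : MatSeq q) (a : ℝ) (j : ℕ) :
    Theta2 s a j a = -momentFunctional s (orthoPoly (sLower s a) j) := by
  cases j with
  | zero => rw [Theta2, momentFunctional_orthoPoly_zero]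
  | succ j =>
    rw [Theta2, Matrix.mul_assoc, R_mul_uTilde2, Matrix.mul_neg, momentFunctional_orthoPoly_succ]

theorem mSumOld_eq_invForm (s : MatSeq q) (a : ℝ) (j : ℕ) :
    mSumOld s a j =
      invForm s (fun i => algebraMap ℂ (Matrix (Fin q) (Fin q) ℂ) a ^ i) j := by
  rw [mSumOld, invForm, ← R_mul_v, Matrix.conjTranspose_mul, H1, ← Matrix.mul_assoc]

theorem lSumOld_eq_invForm (s : MatSeq q) (a : ℝ) (j : ℕ) :
    lSumOld s a j = invForm (sLower s a) s j := by
  have col_eq : blockCol s j = -(R q j a * uTilde2 s a j) := by rw [R_mul_uTilde2, neg_neg]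
  rw [lSumOld, invForm, col_eq, Matrix.conjTranspose_neg, Matrix.conjTranspose_mul, K2,
    Matrix.mul_neg, Matrix.neg_mul, Matrix.neg_mul, neg_neg, ← Matrix.mul_assoc]

theorem lOld_zero (s : MatSeq q) (a : ℝ) : lOld s a 0 = (s 0)ᴴ * (sLower s a 0)⁻¹ * s 0 := by
  have col_eq : uTilde2 s a 0 = -blockCol s 0 := by
    ext ⟨i, c⟩ d
    fin_cases i
    rfl
  rw [lOld, col_eq, ← invForm_zero, invForm, K2, Matrix.conjTranspose_neg, Matrix.mul_neg,
    Matrix.neg_mul, Matrix.neg_mul, neg_neg]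

theorem mOld_eq {s : MatSeq q} (a : ℝ) {j : ℕ} (hs : IsQuasiDefinite s j) :
    mOld s a j = (P1 s j a)ᴴ * (momentNorm s j (orthoPoly s j))⁻¹ * P1 s j a := by
  cases j with
  | zero => simp [mOld, P1, momentNorm_orthoPoly_zero]
  | succ j =>
    rw [mOld, mSumOld_eq_invForm, mSumOld_eq_invForm, hs.invForm_succ, add_sub_cancel_left,
      momentFunctional_pow, ← P1_eq_eval]

theorem lOld_eq {s : MatSeq q} {a : ℝ} {j : ℕ} (hf : IsQuasiDefinite (sLower s a) j) :
    lOld s a j = (Theta2 s a j a)ᴴ *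
      (momentNorm (sLower s a) j (orthoPoly (sLower s a) j))⁻¹ * Theta2 s a j a := by
  rw [Theta2_eq_neg_momentFunctional, Matrix.conjTranspose_neg, Matrix.mul_neg, Matrix.neg_mul,
    Matrix.neg_mul, neg_neg]
  cases j with
  | zero => rw [lOld_zero, momentNorm_orthoPoly_zero, momentFunctional_orthoPoly_zero]
  | succ j =>
    rw [lOld, lSumOld_eq_invForm, lSumOld_eq_invForm, hf.invForm_succ, add_sub_cancel_left]

theorem isSelfAdjoint_ofReal (a : ℝ) : IsSelfAdjoint (a : ℂ) :=
  Complex.conj_ofReal a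

theorem isSelfAdjoint_of_sLower {s : MatSeq q} {a : ℝ} {n : ℕ} (hs : IsQuasiDefinite s n)
    (hf : IsQuasiDefinite (sLower s a) n) {k : ℕ} (hk : k ≤ 2 * n + 1) : IsSelfAdjoint (s k) := by
  obtain hk | rfl := hk.lt_or_eq
  · exact hs.isSelfAdjoint (by omega)
  · have h := (hf.isSelfAdjoint (k := 2 * n) (by omega)).add
      ((isSelfAdjoint_ofReal a).smul (hs.isSelfAdjoint (k := 2 * n) (by omega)))
    rwa [sLower, neg_add_cancel_comm] at h

section

variable {s : MatSeq q} {a : ℝ} {j : ℕ} (hs : IsQuasiDefinite s j)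
  (hf : IsQuasiDefinite (sLower s a) j)
include hs hf

theorem momentNorm_orthoPoly_eq :
    momentNorm s j (orthoPoly s j) = -Theta2 s a j a * (P1 s j a)ᴴ := by
  have hp : IsMonicOrthogonal s j (orthoPoly s j) :=
    isMonicOrthogonal_orthoPoly (fun k hk => hs.isSelfAdjoint (by omega)) fun i hi =>
      hs.isUnit i hi.le
  have hr : IsMonicOrthogonal (sLower s a) j (orthoPoly (sLower s a) j) :=
    isMonicOrthogonal_orthoPoly (fun k hk => hf.isSelfAdjoint (by omega)) fun i hi =>
      hf.isUnit i hi.le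
  rw [← (hp.isSelfAdjoint_momentNorm fun k hk => hs.isSelfAdjoint hk).star_eq,
    hp.momentNorm_eq hr (Algebra.commutes (a : ℂ)) ((isSelfAdjoint_ofReal a).algebraMap _)
      (sLower_eq_sub s a) fun k hk => hs.isSelfAdjoint hk,
    star_mul, star_star, Theta2_eq_neg_momentFunctional, neg_neg, P1_eq_eval]
  rfl

theorem momentNorm_sLower_eq :
    momentNorm (sLower s a) j (orthoPoly (sLower s a) j) =
      P1 s (j + 1) a * (Theta2 s a j a)ᴴ := by
  have hg (k : ℕ) (hk : k ≤ 2 * j + 1) : IsSelfAdjoint (s k) := isSelfAdjoint_of_sLower hs hf hk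
  have hp : IsMonicOrthogonal s (j + 1) (orthoPoly s (j + 1)) :=
    isMonicOrthogonal_orthoPoly (fun k hk => hg k (by omega)) fun i hi =>
      hs.isUnit i (Nat.lt_succ_iff.mp hi)
  have hr : IsMonicOrthogonal (sLower s a) j (orthoPoly (sLower s a) j) :=
    isMonicOrthogonal_orthoPoly (fun k hk => hf.isSelfAdjoint (by omega)) fun i hi =>
      hf.isUnit i hi.le
  rw [Theta2_eq_neg_momentFunctional, P1_eq_eval, Matrix.conjTranspose_neg, Matrix.mul_neg]
  exact hp.momentNorm_shift_eq hr (Algebra.commutes (a : ℂ))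
    ((isSelfAdjoint_ofReal a).algebraMap _) (sLower_eq_sub s a) fun k hk => hg k (by omega)

theorem isUnit_Theta2 : IsUnit (Theta2 s a j a) :=
  (IsUnit.neg_iff _).mp <| isUnit_of_mul_isUnit_left <|
    momentNorm_orthoPoly_eq hs hf ▸ hs.isUnit_momentNorm

theorem isUnit_P1_succ : IsUnit (P1 s (j + 1) a) :=
  isUnit_of_mul_isUnit_left <| momentNorm_sLower_eq hs hf ▸ hf.isUnit_momentNorm

theorem mOld_eq_inv_Theta2_mul_P1 : mOld s a j = -((Theta2 s a j a)⁻¹ * P1 s j a) := by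
  have hN := hs.isUnit_momentNorm
  rw [momentNorm_orthoPoly_eq hs hf] at hN
  rw [mOld_eq a hs, momentNorm_orthoPoly_eq hs hf,
    mul_mul_inv_cancel_left_of_isUnit _ (isUnit_of_mul_isUnit_right hN),
    inv_neg_of_isUnit (isUnit_Theta2 hs hf), Matrix.neg_mul]

theorem lOld_eq_inv_P1_mul_Theta2 : lOld s a j = (P1 s (j + 1) a)⁻¹ * Theta2 s a j a := by
  have hN := hf.isUnit_momentNorm
  rw [momentNorm_sLower_eq hs hf] at hN
  rw [lOld_eq hf, momentNorm_sLower_eq hs hf,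
    mul_mul_inv_cancel_left_of_isUnit _ (isUnit_of_mul_isUnit_right hN)]

end

theorem sLower_sUpper (s : MatSeq q) (a b : ℝ) : sLower (sUpper s b) a = sHat s a b := by
  funext k
  simp only [sLower, sUpper, sHat, smul_sub, smul_smul, Complex.ofReal_mul, Complex.ofReal_add,
    add_smul]
  abel

theorem u2_add (s : MatSeq q) (a b : ℝ) (j : ℕ) :
    u2 s a b j + (a : ℂ) • (v q j * s 0) = uTilde2 (sUpper s b) a j := by
  have v_mul : v q j * s 0 = blockCol (fun k => if k = 0 then s 0 else 0) j := by
    ext ⟨⟨i, hi⟩, c⟩ d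
    cases i <;> simp [v, blockCol, Matrix.mul_apply, Matrix.one_apply]
  have block_zero : u20 s a b + (a : ℂ) • s 0 = -sUpper s b 0 := by
    simp only [u20, sUpper, Complex.ofReal_add, add_smul]
    abel
  rw [v_mul]
  ext ⟨⟨i, hi⟩, c⟩ d
  cases i with
  | zero => simpa [u2, uTilde2, blockCol] using congr_fun₂ block_zero c d
  | succ i => simp [u2, uTilde2, blockCol, ← sLower_sUpper, sLower]

theorem Gamma1_eq_P1_sUpper (s : MatSeq q) (b : ℝ) (j : ℕ) (z : ℂ) :
    Gamma1 s b j z = P1 (sUpper s b) j z := by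
  cases j <;> rfl

theorem Q2_eq_neg_Theta2_sUpper (s : MatSeq q) (a b : ℝ) (j : ℕ) :
    Q2 s a b j a = -Theta2 (sUpper s b) a j a := by
  cases j with
  | zero =>
    simp only [Q2, Theta2, u20, sUpper, Complex.ofReal_add, add_smul]
    abel
  | succ j => rw [Q2, u2_add, Theta2, sLower_sUpper]

theorem mNew_eq_mOld_sUpper (s : MatSeq q) (a b : ℝ) (j : ℕ) :
    mNew s a b j = mOld (sUpper s b) a j := by
  cases j with
  | zero =>
    refine (mSumOld_eq_invForm (sUpper s b) a 0).trans ?_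
    simp [invForm_zero, mOld]
  | succ j => rfl

theorem lNew_eq_lOld_sUpper {s : MatSeq q} (hs : (s 0).IsHermitian) (a b : ℝ) (j : ℕ) :
    lNew s a b j = lOld (sUpper s b) a j := by
  have row_eq (i : ℕ) :
      (u2 s a b i)ᴴ + (a : ℂ) • (s 0 * (v q i)ᴴ) = (uTilde2 (sUpper s b) a i)ᴴ := by
    rw [← u2_add, Matrix.conjTranspose_add, Matrix.conjTranspose_smul, Matrix.conjTranspose_mul,
      hs.eq, RCLike.star_def, Complex.conj_ofReal]
  have H2_eq (i : ℕ) : H2 s a b i = K2 (sUpper s b) a i := by rw [H2, K2, sLower_sUpper]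
  cases j with
  | zero => rw [lNew, lOld, row_eq, u2_add, H2_eq]
  | succ j => simp only [lNew, lOld, lSum, lSumOld, row_eq, u2_add, H2_eq]

section

variable {s : MatSeq q} {a b : ℝ} {j : ℕ} (hU : IsQuasiDefinite (sUpper s b) j)
  (hH : IsQuasiDefinite (sHat s a b) j)
include hU hH

theorem isUnit_Q2 : IsUnit (Q2 s a b j a) := by
  rw [← sLower_sUpper] at hH
  exact Q2_eq_neg_Theta2_sUpper s a b j ▸ (isUnit_Theta2 hU hH).neg

theorem isUnit_Gamma1_succ : IsUnit (Gamma1 s b (j + 1) a) := by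
  rw [← sLower_sUpper] at hH
  exact Gamma1_eq_P1_sUpper s b (j + 1) a ▸ isUnit_P1_succ hU hH

theorem mNew_eq_inv_Q2_mul_Gamma1 : mNew s a b j = (Q2 s a b j a)⁻¹ * Gamma1 s b j a := by
  rw [← sLower_sUpper] at hH
  rw [mNew_eq_mOld_sUpper, Gamma1_eq_P1_sUpper, Q2_eq_neg_Theta2_sUpper,
    mOld_eq_inv_Theta2_mul_P1 hU hH, inv_neg_of_isUnit (isUnit_Theta2 hU hH), Matrix.neg_mul]

theorem lNew_eq_inv_Gamma1_mul_Q2 (hs : (s 0).IsHermitian) :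
    lNew s a b j = -((Gamma1 s b (j + 1) a)⁻¹ * Q2 s a b j a) := by
  rw [← sLower_sUpper] at hH
  rw [lNew_eq_lOld_sUpper hs, Gamma1_eq_P1_sUpper, Q2_eq_neg_Theta2_sUpper,
    lOld_eq_inv_P1_mul_Theta2 hU hH, Matrix.mul_neg, neg_neg]

end

end Stieltjes

section Positivity

variable {q : ℕ}

theorem IsQuasiDefinite.of_posDef {f : MatSeq q} {n : ℕ} (hf : (blockHankel f n).PosDef) :
    IsQuasiDefinite f n where
  isHermitian := hf.isHermitian
  isUnit j hj := by
    have hinj : Function.Injective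
        (Prod.map (Fin.castLE (Nat.succ_le_succ hj)) id : Fin (j + 1) × Fin q → _) :=
      (Fin.castLE_injective _).prodMap Function.injective_id
    exact (hf.submatrix hinj).isUnit

theorem posDef_blockHankel_of_sUpper_sLower {s : MatSeq q} {a b : ℝ} {n : ℕ} (hab : a < b)
    (hU : (blockHankel (sUpper s b) n).PosSemidef) (hL : (blockHankel (sLower s a) n).PosDef) :
    (blockHankel s n).PosDef := by
  have hba : 0 < b - a := sub_pos.mpr hab
  have sum_eq : blockHankel (sUpper s b) n + blockHankel (sLower s a) n =
      (b - a) • blockHankel s n := by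
    ext p r
    simp only [blockHankel, sUpper, sLower, Matrix.add_apply, Matrix.sub_apply, Matrix.neg_apply,
      Matrix.smul_apply, Matrix.of_apply, smul_eq_mul, Complex.real_smul, Complex.ofReal_sub]
    ring
  rw [← inv_smul_smul₀ hba.ne' (blockHankel s n), ← sum_eq]
  exact (hL.posSemidef_add hU).smul (inv_pos.mpr hba)

theorem posSemidef_blockHankel_sUpper_sUpper {s : MatSeq q} {n : ℕ} (b : ℝ)
    (hs : (blockHankel s (n + 1)).PosSemidef) :
    (blockHankel (sUpper (sUpper s b) b) n).PosSemidef := by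
  -- `B` is multiplication by `b - x` in the monomial basis
  let B : Matrix (Fin (n + 2) × Fin q) (Fin (n + 1) × Fin q) ℂ :=
    (b : ℂ) • (1 : Matrix _ _ ℂ).submatrix (Equiv.refl _) (Prod.map Fin.castSucc id) -
      (1 : Matrix _ _ ℂ).submatrix (Equiv.refl _) (Prod.map Fin.succ id)
  convert hs.conjTranspose_mul_mul_same B using 1
  simp only [B, Matrix.conjTranspose_sub, Matrix.conjTranspose_smul, Matrix.conjTranspose_submatrix,
    Matrix.conjTranspose_one, Matrix.sub_mul, Matrix.mul_sub, Matrix.smul_mul, Matrix.mul_smul,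
    Matrix.mul_submatrix_one, Matrix.one_submatrix_mul]
  ext p r
  simp [blockHankel, sUpper, add_right_comm, ← add_assoc]

theorem HausdorffPosDefOdd.isQuasiDefinite_sLower {s : MatSeq q} {a b : ℝ} {n : ℕ}
    (h : HausdorffPosDefOdd s a b n) : IsQuasiDefinite (sLower s a) n :=
  .of_posDef h.2

theorem HausdorffPosDefOdd.isQuasiDefinite {s : MatSeq q} {a b : ℝ} {n : ℕ} (hab : a < b)
    (h : HausdorffPosDefOdd s a b n) : IsQuasiDefinite s n :=
  .of_posDef (posDef_blockHankel_of_sUpper_sLower hab h.1.posSemidef h.2)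

theorem HausdorffPosDefEven.isHermitian_zero {s : MatSeq q} {a b : ℝ} {n : ℕ}
    (h : HausdorffPosDefEven s a b n) : (s 0).IsHermitian :=
  (IsQuasiDefinite.of_posDef h.1).isSelfAdjoint (Nat.zero_le _)

theorem HausdorffPosDefEven.isQuasiDefinite_sHat {s : MatSeq q} {a b : ℝ} {n : ℕ} (hn : 1 ≤ n)
    (h : HausdorffPosDefEven s a b n) : IsQuasiDefinite (sHat s a b) (n - 1) :=
  .of_posDef (h.2 (n - 1) (Nat.sub_add_cancel hn))

theorem HausdorffPosDefEven.isQuasiDefinite_sUpper {s : MatSeq q} {a b : ℝ} {n : ℕ} (hab : a < b)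
    (hn : 1 ≤ n) (h : HausdorffPosDefEven s a b n) : IsQuasiDefinite (sUpper s b) (n - 1) := by
  obtain ⟨n, rfl⟩ := Nat.exists_eq_add_of_le' hn
  refine .of_posDef (posDef_blockHankel_of_sUpper_sLower hab
    (posSemidef_blockHankel_sUpper_sUpper b h.1.posSemidef) ?_)
  rw [sLower_sUpper]
  exact h.2 n rfl

end Positivity

end HausdorffMoment

theorem proposition7p6_general (q n : ℕ) (a b : ℝ) (s : ℕ → Matrix (Fin q) (Fin q) ℂ) :
    ((s 0).IsHermitian → IsQuasiDefinite (sUpper s b) n → IsQuasiDefinite (sHat s a b) n →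
      mNew s a b 0 = (Q2 s a b 0 a)⁻¹ ∧
      (∀ j, j ≤ n → IsUnit (Q2 s a b j a) ∧
        mNew s a b j = (Q2 s a b j a)⁻¹ * Gamma1 s b j a) ∧
      (∀ j, j ≤ n → IsUnit (Gamma1 s b (j + 1) a) ∧
        lNew s a b j = -((Gamma1 s b (j + 1) a)⁻¹ * Q2 s a b j a))) ∧
    (IsQuasiDefinite s n → IsQuasiDefinite (sLower s a) n →
      mOld s a 0 = -(Theta2 s a 0 a)⁻¹ ∧
      (∀ j, j ≤ n → IsUnit (Theta2 s a j a) ∧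
        mOld s a j = -((Theta2 s a j a)⁻¹ * P1 s j a)) ∧
      (∀ j, j ≤ n → IsUnit (P1 s (j + 1) a) ∧
        lOld s a j = (P1 s (j + 1) a)⁻¹ * Theta2 s a j a)) := by
  refine ⟨fun hs hU hH => ⟨?_, fun j hj => ?_, fun j hj => ?_⟩,
    fun hs hL => ⟨?_, fun j hj => ?_, fun j hj => ?_⟩⟩
  · rw [mNew_eq_inv_Q2_mul_Gamma1 (hU.mono n.zero_le) (hH.mono n.zero_le), Gamma1, mul_one]
  · exact ⟨isUnit_Q2 (hU.mono hj) (hH.mono hj),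
      mNew_eq_inv_Q2_mul_Gamma1 (hU.mono hj) (hH.mono hj)⟩
  · exact ⟨isUnit_Gamma1_succ (hU.mono hj) (hH.mono hj),
      lNew_eq_inv_Gamma1_mul_Q2 (hU.mono hj) (hH.mono hj) hs⟩
  · rw [mOld_eq_inv_Theta2_mul_P1 (hs.mono n.zero_le) (hL.mono n.zero_le), P1, mul_one]
  · exact ⟨isUnit_Theta2 (hs.mono hj) (hL.mono hj),
      mOld_eq_inv_Theta2_mul_P1 (hs.mono hj) (hL.mono hj)⟩
  · exact ⟨isUnit_P1_succ (hs.mono hj) (hL.mono hj),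
      lOld_eq_inv_P1_mul_Theta2 (hs.mono hj) (hL.mono hj)⟩

theorem proposition7p6 (q : ℕ) (n : ℕ) (a b : ℝ) (hab : a < b)
    (s : ℕ → Matrix (Fin q) (Fin q) ℂ) :
    (1 ≤ n → HausdorffPosDefEven s a b n →
      mNew s a b 0 = (Q2 s a b 0 a)⁻¹ ∧
      (∀ j, j ≤ n - 1 → IsUnit (Q2 s a b j a) ∧
        mNew s a b j = (Q2 s a b j a)⁻¹ * Gamma1 s b j a) ∧
      (∀ j, j ≤ n - 1 → IsUnit (Gamma1 s b (j + 1) a) ∧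
        lNew s a b j = -((Gamma1 s b (j + 1) a)⁻¹ * Q2 s a b j a))) ∧
    (HausdorffPosDefOdd s a b n →
      mOld s a 0 = -(Theta2 s a 0 a)⁻¹ ∧
      IsUnit (Theta2 s a 0 a) ∧
      (∀ j, 1 ≤ j → j ≤ n → IsUnit (Theta2 s a j a) ∧
        mOld s a j = -((Theta2 s a j a)⁻¹ * P1 s j a)) ∧
      (∀ j, j ≤ n → IsUnit (P1 s (j + 1) a) ∧
        lOld s a j = (P1 s (j + 1) a)⁻¹ * Theta2 s a j a)) :=
  ⟨fun hn h => (proposition7p6_general q (n - 1) a b s).1 h.isHermitian_zero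
      (h.isQuasiDefinite_sUpper hab hn) (h.isQuasiDefinite_sHat hn),
    fun h =>
      have ⟨hM₀, hM, hL⟩ := (proposition7p6_general q n a b s).2 (h.isQuasiDefinite hab)
        h.isQuasiDefinite_sLower
      ⟨hM₀, (hM 0 n.zero_le).1, fun j _ => hM j, hL⟩⟩
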